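/- Let $\mathbb{k}$ be a field of characteristic zero. A variety $\mathfrak{M}$ of non-associative $\mathbb{k}$-algebras is an equational theory in one binary bilinear product: the class of all algebras satisfying a given set of identities. It is a *2-variety* if, for every algebra $A$ in $\mathfrak{M}$ and every two-sided ideal $I$ of $A$, the linear span $I^2$ of all products of two elements of $I$ is also an ideal of $A$. It is *trivial* if the product of every algebra in $\mathfrak{M}$ is identically zero. The operad encoding $\mathfrak{M}$ has as its $n$-th component $\mathcal{O}(n)$, $n\ge 1$, the vector space of multilinear elements (elements of multidegree $(1,\dots,1)$) in the free algebra $F_{\mathfrak{M}}\langle x_1,\dots,x_n\rangle$ of $\mathfrak{M}$. **Lemma 3.3.** Let $\mathfrak{M}$ be a 2-variety of non-associative $\mathbb{k}$-algebras encoded by the operad $\mathcal{O}$. One of the following possibilities occurs: - $\mathcal{O}(2)=\{0\}$, and $\mathfrak{M}$ is trivial; - $\dim\mathcal{O}(2)=1$, and one of the following holds: - $\dim\mathcal{O}(3)=2$, and $\dim\mathcal{O}(n)\le (n-1)!$ for all $n\ge 1$; - $\dim\mathcal{O}(3)=1$, and $\dim\mathcal{O}(n)\le 1$ for all $n\ge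 1$; - $\dim\mathcal{O}(3)=0$; - $\dim\mathcal{O}(2)=2$, and $\dim\mathcal{O}(n)\le 2^{n-1}(n-1)!$ for all $n\ge 1$. -/

import Mathlib

universe u v

noncomputable section

/-- A variety of non-associative `k`-algebras, given as an equational theory: a set of identities
`p = 0`, each `p` being a non-associative polynomial without constant term in the countably many
variables indexed by `ℕ`. -/
abbrev NAVariety (k : Type u) [Field k] : Type u :=
  Set (FreeNonUnitalNonAssocAlgebra k ℕ)

namespace NAVariety

variable {k : Type u} [Field k]

/-- The algebra `A` belongs to the variety `M`: every defining identity of `M` vanishes under every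
substitution of elements of `A` for the variables. -/
def Models (M : NAVariety k) (A : Type v) [NonUnitalNonAssocRing A] [Module k A]
    [IsScalarTower k A A] [SMulCommClass k A A] : Prop :=
  ∀ p : FreeNonUnitalNonAssocAlgebra k ℕ, p ∈ M →
    ∀ f : ℕ → A, FreeNonUnitalNonAssocAlgebra.lift k f p = 0

/-- A subspace `I` of an algebra `A` is a (two-sided) ideal. -/
def IsIdeal {A : Type v} [NonUnitalNonAssocRing A] [Module k A] (I : Submodule k A) : Prop :=
  ∀ a : A, ∀ x ∈ I, a * x ∈ I ∧ x * a ∈ I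

/-- The subspace `I ^ 2`: the linear span of all products of two elements of `I`. -/
def square {A : Type v} [NonUnitalNonAssocRing A] [Module k A] (I : Submodule k A) :
    Submodule k A :=
  Submodule.span k {z : A | ∃ x ∈ I, ∃ y ∈ I, x * y = z}

/-- `M` is a 2-variety: for every ideal `I` in every algebra of `M`, `I ^ 2` is also an ideal. -/
def IsTwoVariety (M : NAVariety k) : Prop :=
  ∀ (A : Type u) [NonUnitalNonAssocRing A] [Module k A] [IsScalarTower k A A]
    [SMulCommClass k A A], M.Models A →
    ∀ I : Submodule k A, IsIdeal I → IsIdeal (square I)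

/-- `M` is trivial: the product of every algebra of `M` is identically zero. -/
def IsTrivial (M : NAVariety k) : Prop :=
  ∀ (A : Type u) [NonUnitalNonAssocRing A] [Module k A] [IsScalarTower k A A]
    [SMulCommClass k A A], M.Models A → ∀ a b : A, a * b = 0

/-- The identities in the variables `X` that hold in all algebras of `M`. -/
def identities (M : NAVariety k) (X : Type v) :
    Submodule k (FreeNonUnitalNonAssocAlgebra k X) where
  carrier := {p | ∀ (A : Type u) [NonUnitalNonAssocRing A] [Module k A] [IsScalarTower k A A]
    [SMulCommClass k A A], M.Models A →
    ∀ f : X → A, FreeNonUnitalNonAssocAlgebra.lift k f p = 0}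
  add_mem' {p q} hp hq A _ _ _ _ hA f := by rw [map_add, hp A hA f, hq A hA f, add_zero]
  zero_mem' A _ _ _ _ _ f := map_zero _
  smul_mem' c p hp A _ _ _ _ hA f := by rw [map_smul, hp A hA f, smul_zero]

/-- The free algebra `F_M⟨X⟩` of the variety `M` on the set `X`: the quotient of the absolutely
free algebra by the ideal of all identities of `M`. -/
def FreeAlg (M : NAVariety k) (X : Type v) : Type (max u v) :=
  FreeNonUnitalNonAssocAlgebra k X ⧸ M.identities X

namespace FreeAlg

variable (M : NAVariety k) (X : Type v)

instance : AddCommGroup (M.FreeAlg X) :=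
  inferInstanceAs (AddCommGroup (FreeNonUnitalNonAssocAlgebra k X ⧸ M.identities X))

instance : Module k (M.FreeAlg X) :=
  inferInstanceAs (Module k (FreeNonUnitalNonAssocAlgebra k X ⧸ M.identities X))

/-- The projection of the absolutely free algebra onto the free algebra of `M`. -/
def mk : FreeNonUnitalNonAssocAlgebra k X →ₗ[k] M.FreeAlg X :=
  (M.identities X).mkQ

theorem mk_surjective : Function.Surjective (mk M X) :=
  Submodule.mkQ_surjective _

theorem mk_eq_zero_iff (p : FreeNonUnitalNonAssocAlgebra k X) :
    mk M X p = 0 ↔ p ∈ M.identities X :=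
  Submodule.Quotient.mk_eq_zero _

theorem mul_congr {p p' q q' : FreeNonUnitalNonAssocAlgebra k X}
    (hp : mk M X p = mk M X p') (hq : mk M X q = mk M X q') :
    mk M X (p * q) = mk M X (p' * q') := by
  rw [← sub_eq_zero, ← map_sub, mk_eq_zero_iff] at *
  intro A _ _ _ _ hA f
  have h1 := hp A hA f
  have h2 := hq A hA f
  rw [map_sub, sub_eq_zero] at *
  rw [map_mul, map_mul, h1, h2]

/-- The product of the free algebra of `M`, induced from the absolutely free algebra. -/
instance : Mul (M.FreeAlg X) :=
  ⟨fun a b => mk M X ((mk_surjective M X a).choose * (mk_surjective M X b).choose)⟩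

theorem mk_mul (p q : FreeNonUnitalNonAssocAlgebra k X) :
    mk M X (p * q) = mk M X p * mk M X q :=
  mul_congr M X (mk_surjective M X (mk M X p)).choose_spec.symm
    (mk_surjective M X (mk M X q)).choose_spec.symm

instance : NonUnitalNonAssocRing (M.FreeAlg X) :=
  { (inferInstance : AddCommGroup (M.FreeAlg X)), (inferInstance : Mul (M.FreeAlg X)) with
    left_distrib := fun a b c => by
      obtain ⟨p, rfl⟩ := mk_surjective M X a
      obtain ⟨q, rfl⟩ := mk_surjective M X b
      obtain ⟨r, rfl⟩ := mk_surjective M X c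
      simp only [← map_add, ← mk_mul, mul_add]
    right_distrib := fun a b c => by
      obtain ⟨p, rfl⟩ := mk_surjective M X a
      obtain ⟨q, rfl⟩ := mk_surjective M X b
      obtain ⟨r, rfl⟩ := mk_surjective M X c
      simp only [← map_add, ← mk_mul, add_mul]
    zero_mul := fun a => by
      obtain ⟨p, rfl⟩ := mk_surjective M X a
      rw [← map_zero (mk M X), ← mk_mul, zero_mul]
    mul_zero := fun a => by
      obtain ⟨p, rfl⟩ := mk_surjective M X a
      rw [← map_zero (mk M X), ← mk_mul, mul_zero] }

instance : IsScalarTower k (M.FreeAlg X) (M.FreeAlg X) where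
  smul_assoc c a b := by
    obtain ⟨p, rfl⟩ := mk_surjective M X a
    obtain ⟨q, rfl⟩ := mk_surjective M X b
    simp only [smul_eq_mul, ← map_smul, ← mk_mul, smul_mul_assoc]

instance : SMulCommClass k (M.FreeAlg X) (M.FreeAlg X) where
  smul_comm c a b := by
    obtain ⟨p, rfl⟩ := mk_surjective M X a
    obtain ⟨q, rfl⟩ := mk_surjective M X b
    simp only [smul_eq_mul, ← map_smul, ← mk_mul, mul_smul_comm]

/-- The free generators. -/
def gen (x : X) : M.FreeAlg X :=
  mk M X (FreeNonUnitalNonAssocAlgebra.of k x)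

end FreeAlg

/-- The multiset of letters of a non-associative word. -/
def letters {X : Type v} : FreeMagma X → Multiset X
  | FreeMagma.of x => {x}
  | FreeMagma.mul s t => letters s + letters t

/-- The component `O(n)` of the operad encoding `M`: the subspace of multilinear elements, that is
of elements of multidegree `(1, …, 1)`, in the free algebra of `M` on `n` generators. It is spanned
by the values, at the free generators, of the non-associative words in which each of the `n`
letters occurs exactly once. -/
def operad (M : NAVariety k) (n : ℕ) : Submodule k (M.FreeAlg (Fin n)) :=
  Submodule.span k {z | ∃ w : FreeMagma (Fin n),
    (∀ i : Fin n, (letters w).count i = 1) ∧ FreeMagma.lift (FreeAlg.gen M (Fin n)) w = z}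

end NAVariety

end

/-! Apply the 2-variety condition to the free algebra on x, y, z and the ideal I generated by x and
y. Since xy lies in I², so do (xy)z and z(xy). But I² is spanned by products of two words that each
involve x or y, and over an infinite field only the words of multidegree (1,1,1) matter. In these, z
sits in an inner bracket with x or with y: `IsTwoVariety.mem_span_innerProducts`.

By induction, this rewrites any multilinear word as a combination of combs that start at a fixed
letter and absorb the others one at a time, on the left or on the right (`lift_mem_combSpan`).
Counting combs gives the bound 2^(n-1)(n-1)!, hence dim O(2) ≤ 2.

If dim O(2) = 1, the product is commutative or anticommutative, so sides do not matter and (n-1)!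
combs remain; in particular dim O(3) ≤ 2. If moreover dim O(3) = 1, then (yz)x is invariant under
cyclic shifts, left multiplications commute up to a scalar, and all combs are proportional. -/

open FreeNonUnitalNonAssocAlgebra (lift)

namespace NAVariety

/-! ### Words as a basis, and multidegree components -/

section Words

variable (k : Type u) [Field k] {X : Type v}

/-- The basis of the absolutely free algebra formed by the non-associative words. -/
noncomputable def wordBasis (X : Type v) :
    Module.Basis (FreeMagma X) k (FreeNonUnitalNonAssocAlgebra k X) :=
  .ofRepr (MonoidAlgebra.coeffLinearEquiv k)

theorem wordBasis_eq (w : FreeMagma X) :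
    wordBasis k X w = FreeMagma.lift (FreeNonUnitalNonAssocAlgebra.of k) w := by
  have h : wordBasis k X w = MonoidAlgebra.ofMagma k _ w := by
    simp [wordBasis, MonoidAlgebra.coeffLinearEquiv]
  rw [h]
  exact DFunLike.congr_fun
    (FreeMagma.lift.apply_symm_apply (MonoidAlgebra.ofMagma k (FreeMagma X))).symm w

theorem wordBasis_of (x : X) :
    wordBasis k X (FreeMagma.of x) = FreeNonUnitalNonAssocAlgebra.of k x := by
  rw [wordBasis_eq, FreeMagma.lift_of]

theorem wordBasis_mul (a b : FreeMagma X) :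
    wordBasis k X (a * b) = wordBasis k X a * wordBasis k X b := by
  rw [wordBasis_eq, wordBasis_eq, wordBasis_eq, map_mul]

theorem letters_mul (a b : FreeMagma X) : letters (a * b) = letters a + letters b := rfl

theorem letters_of (x : X) : letters (FreeMagma.of x) = {x} := rfl

variable {k}

theorem lift_wordBasis {A : Type*} [NonUnitalNonAssocRing A] [Module k A]
    [IsScalarTower k A A] [SMulCommClass k A A] (f : X → A) (w : FreeMagma X) :
    lift k f (wordBasis k X w) = FreeMagma.lift f w := by
  induction w with
  | ih1 x => rw [wordBasis_of, FreeNonUnitalNonAssocAlgebra.lift_of_apply, FreeMagma.lift_of]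
  | ih2 a b ha hb => rw [wordBasis_mul, map_mul, map_mul, ha, hb]

theorem lift_lift {Y : Type*} {A : Type*} [NonUnitalNonAssocRing A] [Module k A]
    [IsScalarTower k A A] [SMulCommClass k A A] (f : X → A)
    (g : Y → FreeNonUnitalNonAssocAlgebra k X) (p : FreeNonUnitalNonAssocAlgebra k Y) :
    lift k f (lift k g p) = lift k (fun y ↦ lift k f (g y)) p := by
  have h : (lift k f).comp (lift k g) = lift k fun y ↦ lift k f (g y) := by
    refine FreeNonUnitalNonAssocAlgebra.hom_ext k fun y ↦ ?_
    rw [NonUnitalAlgHom.comp_apply, FreeNonUnitalNonAssocAlgebra.lift_of_apply,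
      FreeNonUnitalNonAssocAlgebra.lift_of_apply]
  exact DFunLike.congr_fun h p

/-- Rescaling the variables multiplies a word by the corresponding monomial. -/
theorem lift_smul_wordBasis [DecidableEq X] (t : X → k) (w : FreeMagma X) :
    lift k (fun x ↦ t x • FreeNonUnitalNonAssocAlgebra.of k x) (wordBasis k X w) =
      MvPolynomial.eval t (MvPolynomial.monomial (Multiset.toFinsupp (letters w)) 1) •
        wordBasis k X w := by
  induction w with
  | ih1 x =>
    rw [wordBasis_of, FreeNonUnitalNonAssocAlgebra.lift_of_apply, letters_of,
      Multiset.toFinsupp_singleton]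
    simp [MvPolynomial.eval_monomial]
  | ih2 a b ha hb =>
    rw [wordBasis_mul, map_mul, ha, hb, letters_mul, Multiset.toFinsupp_add,
      smul_mul_smul_comm, ← map_mul, MvPolynomial.monomial_mul, one_mul]

/-- The projection of the absolutely free algebra onto its component of multidegree `d`. -/
noncomputable def component [DecidableEq X] (d : X →₀ ℕ) :
    FreeNonUnitalNonAssocAlgebra k X →ₗ[k] FreeNonUnitalNonAssocAlgebra k X :=
  (wordBasis k X).constr k
    fun w ↦ if Multiset.toFinsupp (letters w) = d then wordBasis k X w else 0

theorem component_wordBasis [DecidableEq X] (d : X →₀ ℕ) (w : FreeMagma X) :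
    component (k := k) d (wordBasis k X w) =
      if Multiset.toFinsupp (letters w) = d then wordBasis k X w else 0 :=
  Module.Basis.constr_basis _ _ _ _

end Words

/-! ### Multihomogeneity of identities, and the universal property of the free algebra -/

section Eval

variable {k : Type u} [Field k] {M : NAVariety k} {X : Type v}

/-- Over an infinite field the multihomogeneous components of an identity are identities. -/
theorem component_mem_identities [Infinite k] [DecidableEq X] (d : X →₀ ℕ)
    {p : FreeNonUnitalNonAssocAlgebra k X} (hp : p ∈ M.identities X) :
    component d p ∈ M.identities X := by
  rw [← FreeAlg.mk_eq_zero_iff, ← Module.forall_dual_apply_eq_zero_iff k]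
  intro φ
  let ψ : FreeNonUnitalNonAssocAlgebra k X →ₗ[k] k := φ ∘ₗ FreeAlg.mk M X
  -- Generating polynomial of `ψ` by multidegree: its value at `t` is `ψ` after rescaling each
  -- variable `x` by `t x`, and its coefficient at `d` is `ψ` of the component `d`. Rescaling
  -- preserves identities, so `P p` vanishes as a function, hence as a polynomial.
  let P : FreeNonUnitalNonAssocAlgebra k X →ₗ[k] MvPolynomial X k :=
    (wordBasis k X).constr k fun w ↦
      MvPolynomial.monomial (Multiset.toFinsupp (letters w)) (ψ (wordBasis k X w))
  have hP (w : FreeMagma X) : P (wordBasis k X w) =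
      MvPolynomial.monomial (Multiset.toFinsupp (letters w)) (ψ (wordBasis k X w)) :=
    Module.Basis.constr_basis _ _ _ _
  have heval (t : X → k) : (MvPolynomial.aeval t).toLinearMap ∘ₗ P = ψ ∘ₗ
      (lift k (fun x ↦ t x • FreeNonUnitalNonAssocAlgebra.of k x) :
        FreeNonUnitalNonAssocAlgebra k X →ₗ[k] FreeNonUnitalNonAssocAlgebra k X) := by
    refine (wordBasis k X).ext fun w ↦ ?_
    have := lift_smul_wordBasis t w
    simp only [LinearMap.comp_apply, hP, AlgHom.toLinearMap_apply, LinearMap.coe_coe]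
    erw [this]
    simp [MvPolynomial.aeval_monomial, MvPolynomial.eval_monomial, mul_comm]
  have hcoeff : MvPolynomial.lcoeff k d ∘ₗ P = ψ ∘ₗ component d := by
    refine (wordBasis k X).ext fun w ↦ ?_
    simp only [LinearMap.comp_apply, hP, component_wordBasis, MvPolynomial.lcoeff_apply,
      MvPolynomial.coeff_monomial]
    split_ifs <;> simp
  have hzero : P p = 0 := by
    refine MvPolynomial.funext fun t ↦ ?_
    have h := LinearMap.congr_fun (heval t) p
    simp only [LinearMap.comp_apply, AlgHom.toLinearMap_apply, MvPolynomial.aeval_eq_eval] at h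
    rw [map_zero]
    refine h.trans ?_
    have : lift k (fun x ↦ t x • FreeNonUnitalNonAssocAlgebra.of k x) p ∈ M.identities X := by
      intro A _ _ _ _ hA f
      rw [lift_lift]
      exact hp A hA _
    have h0 := (FreeAlg.mk_eq_zero_iff M X _).2 this
    exact (congrArg φ h0).trans (map_zero φ)
  have h := LinearMap.congr_fun hcoeff p
  rw [LinearMap.comp_apply, hzero, map_zero] at h
  exact h.symm

section

variable {A : Type u} [NonUnitalNonAssocRing A] [Module k A]
  [IsScalarTower k A A] [SMulCommClass k A A]

/-- The homomorphism from the free algebra of `M` to an algebra of `M` given by the images of the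
generators. -/
noncomputable def eval (hA : M.Models A) (f : X → A) : M.FreeAlg X →ₗ[k] A :=
  (M.identities X).liftQ (lift k f : FreeNonUnitalNonAssocAlgebra k X →ₗ[k] A)
    fun _ hp ↦ hp A hA f

theorem eval_mk (hA : M.Models A) (f : X → A) (p : FreeNonUnitalNonAssocAlgebra k X) :
    eval hA f (FreeAlg.mk M X p) = lift k f p :=
  Submodule.liftQ_apply _ _ _

theorem eval_gen (hA : M.Models A) (f : X → A) (x : X) :
    eval hA f (FreeAlg.gen M X x) = f x := by
  rw [FreeAlg.gen, eval_mk, FreeNonUnitalNonAssocAlgebra.lift_of_apply]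

theorem eval_mul (hA : M.Models A) (f : X → A) (a b : M.FreeAlg X) :
    eval hA f (a * b) = eval hA f a * eval hA f b := by
  obtain ⟨p, rfl⟩ := FreeAlg.mk_surjective M X a
  obtain ⟨q, rfl⟩ := FreeAlg.mk_surjective M X b
  rw [← FreeAlg.mk_mul, eval_mk, eval_mk, eval_mk, map_mul]

end

theorem mk_wordBasis (w : FreeMagma X) :
    FreeAlg.mk M X (wordBasis k X w) = FreeMagma.lift (FreeAlg.gen M X) w := by
  induction w with
  | ih1 x => rw [wordBasis_of, FreeMagma.lift_of, FreeAlg.gen]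
  | ih2 a b ha hb => rw [wordBasis_mul, FreeAlg.mk_mul, map_mul, ha, hb]

variable (M X) in
/-- The free algebra of `M` belongs to `M`. -/
theorem models_freeAlg : M.Models (M.FreeAlg X) := by
  intro p hp f
  choose g hg using fun n ↦ FreeAlg.mk_surjective M X (f n)
  let π : FreeNonUnitalNonAssocAlgebra k X →ₙₐ[k] M.FreeAlg X :=
    { FreeAlg.mk M X with
      map_zero' := map_zero (FreeAlg.mk M X)
      map_mul' := FreeAlg.mk_mul M X }
  have hπ : lift k f = π.comp (lift k g) := by
    refine FreeNonUnitalNonAssocAlgebra.hom_ext k fun n ↦ ?_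
    rw [NonUnitalAlgHom.comp_apply, FreeNonUnitalNonAssocAlgebra.lift_of_apply,
      FreeNonUnitalNonAssocAlgebra.lift_of_apply]
    exact (hg n).symm
  rw [hπ]
  have hmem : lift k g p ∈ M.identities X := by
    intro A _ _ _ _ hA h
    rw [lift_lift]
    exact hA p hp _
  exact (FreeAlg.mk_eq_zero_iff M X _).2 hmem

end Eval

/-! ### The degree-three rewriting rule of a 2-variety -/

section Identity

variable {k : Type u} [Field k] {X : Type v}

theorem card_letters_pos (w : FreeMagma X) : 0 < (letters w).card := by
  induction w with
  | ih1 x => simp [letters_of]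
  | ih2 a b ha hb => simp [letters_mul, ha]

theorem exists_of_card_letters {w : FreeMagma X} (h : (letters w).card = 1) :
    ∃ i, w = FreeMagma.of i := by
  cases w with
  | of i => exact ⟨i, rfl⟩
  | mul a b =>
    have ha := card_letters_pos a
    have hb := card_letters_pos b
    have : (letters a + letters b).card = 1 := h
    rw [Multiset.card_add] at this
    omega

theorem exists_of_mul_of_card_letters {w : FreeMagma X} (h : (letters w).card = 2) :
    ∃ i j, w = FreeMagma.of i * FreeMagma.of j := by
  cases w with
  | of i => simp [letters] at h
  | mul a b =>
    have ha := card_letters_pos a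
    have hb := card_letters_pos b
    have : (letters a + letters b).card = 2 := h
    rw [Multiset.card_add] at this
    obtain ⟨i, rfl⟩ := exists_of_card_letters (w := a) (by omega)
    obtain ⟨j, rfl⟩ := exists_of_card_letters (w := b) (by omega)
    exact ⟨i, j, rfl⟩

/-- The products of `a`, `b` and `w`, each taken once, with `w` in the inner bracket. -/
def innerProducts {A : Type*} [Mul A] (a b w : A) : Set A :=
  {(a * w) * b, (w * a) * b, b * (a * w), b * (w * a),
    (b * w) * a, (w * b) * a, a * (b * w), a * (w * b)}

/-- With three distinct letters, one factor is a single letter, which must be 0 or 1; the letter 2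
therefore falls in the two-letter factor. -/
theorem lift_mem_innerProducts {A : Type*} [Mul A] (g : Fin 3 → A) {u v : FreeMagma (Fin 3)}
    (hu : 0 ∈ letters u ∨ 1 ∈ letters u) (hv : 0 ∈ letters v ∨ 1 ∈ letters v)
    (h : letters (u * v) = {0, 1, 2}) :
    FreeMagma.lift g (u * v) ∈ innerProducts (g 0) (g 1) (g 2) := by
  have key : ∀ i j l : Fin 3, ({i} + ({j} + {l}) : Multiset (Fin 3)) = {0, 1, 2} →
      (0 ∈ ({i} : Multiset (Fin 3)) ∨ 1 ∈ ({i} : Multiset (Fin 3))) →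
      (i = 0 ∧ j = 1 ∧ l = 2) ∨ (i = 0 ∧ j = 2 ∧ l = 1) ∨ (i = 1 ∧ j = 0 ∧ l = 2) ∨
        (i = 1 ∧ j = 2 ∧ l = 0) := by decide
  have hcard : (letters u).card + (letters v).card = 3 := by
    rw [← Multiset.card_add, ← letters_mul, h]
    rfl
  have hu' : (letters u).card ≠ 0 := by
    rw [Ne, Multiset.card_eq_zero]
    rintro h0
    simp [h0] at hu
  have hv' : (letters v).card ≠ 0 := by
    rw [Ne, Multiset.card_eq_zero]
    rintro h0
    simp [h0] at hv
  rcases (by omega : (letters u).card = 1 ∧ (letters v).card = 2 ∨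
    (letters u).card = 2 ∧ (letters v).card = 1) with ⟨h1, h2⟩ | ⟨h2, h1⟩
  · obtain ⟨i, rfl⟩ := exists_of_card_letters h1
    obtain ⟨j, l, rfl⟩ := exists_of_mul_of_card_letters h2
    simp only [letters_mul, letters_of] at h hu
    rcases key i j l h hu with ⟨rfl, rfl, rfl⟩ | ⟨rfl, rfl, rfl⟩ | ⟨rfl, rfl, rfl⟩ |
      ⟨rfl, rfl, rfl⟩ <;> simp [innerProducts]
  · obtain ⟨i, rfl⟩ := exists_of_card_letters h1
    obtain ⟨j, l, rfl⟩ := exists_of_mul_of_card_letters h2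
    simp only [letters_mul, letters_of] at h hv
    rcases key i j l ((add_comm _ _).trans h) hv with ⟨rfl, rfl, rfl⟩ | ⟨rfl, rfl, rfl⟩ |
      ⟨rfl, rfl, rfl⟩ | ⟨rfl, rfl, rfl⟩ <;> simp [innerProducts]

variable {M : NAVariety k}

/-- An element of multidegree `d` in the span of the values of some words lies in the span of the
values of those of them that have multidegree `d`. -/
theorem mem_span_of_letters_eq [Infinite k] [DecidableEq X] {W : Set (FreeMagma X)}
    {w : FreeMagma X}
    (h : FreeMagma.lift (FreeAlg.gen M X) w ∈
      Submodule.span k (FreeMagma.lift (FreeAlg.gen M X) '' W)) :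
    FreeMagma.lift (FreeAlg.gen M X) w ∈
      Submodule.span k (FreeMagma.lift (FreeAlg.gen M X) '' {v ∈ W | letters v = letters w}) := by
  have himage (W : Set (FreeMagma X)) : FreeMagma.lift (FreeAlg.gen M X) '' W =
      FreeAlg.mk M X '' (wordBasis k X '' W) := by
    rw [Set.image_image]
    simp only [mk_wordBasis]
  rw [himage, Submodule.span_image, ← mk_wordBasis] at h
  obtain ⟨p, hp, hpw⟩ := h
  let d := Multiset.toFinsupp (letters w)
  have hw : component (k := k) d (wordBasis k X w) = wordBasis k X w := by
    rw [component_wordBasis, if_pos rfl]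
  -- The difference of `p` and the word is an identity, so its component of multidegree `d` is one
  -- too.
  have heq : FreeAlg.mk M X (component d p) = FreeAlg.mk M X (wordBasis k X w) := by
    rw [← sub_eq_zero, ← map_sub, FreeAlg.mk_eq_zero_iff] at hpw ⊢
    have := component_mem_identities d hpw
    rwa [map_sub, hw] at this
  rw [himage, Submodule.span_image, ← mk_wordBasis, ← heq]
  refine Submodule.mem_map_of_mem ?_
  have hle : Submodule.span k (wordBasis k X '' W) ≤
      (Submodule.span k (wordBasis k X '' {v ∈ W | letters v = letters w})).comap
        (component d) := by
    rw [Submodule.span_le]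
    rintro _ ⟨v, hv, rfl⟩
    rw [SetLike.mem_coe, Submodule.mem_comap, component_wordBasis]
    split_ifs with hd
    · exact Submodule.subset_span ⟨v, ⟨hv, Multiset.toFinsupp.injective hd⟩, rfl⟩
    · exact zero_mem _
  exact hle hp

theorem mul_mem_span_image2 {A : Type*} [NonUnitalNonAssocRing A] [Module k A]
    [IsScalarTower k A A] [SMulCommClass k A A] {s t : Set A} {a b : A}
    (ha : a ∈ Submodule.span k s) (hb : b ∈ Submodule.span k t) :
    a * b ∈ Submodule.span k (Set.image2 (· * ·) s t) := by
  have h := Submodule.apply_mem_map₂ (LinearMap.mul k A) ha hb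
  rw [Submodule.map₂_span_span] at h
  exact h

theorem span_range_lift_gen :
    Submodule.span k (Set.range (FreeMagma.lift (FreeAlg.gen M X))) = ⊤ := by
  have h : Set.range (FreeMagma.lift (FreeAlg.gen M X)) =
      FreeAlg.mk M X '' Set.range (wordBasis k X) := by
    rw [← Set.range_comp]
    exact congrArg Set.range (funext fun w ↦ (mk_wordBasis w).symm)
  rw [h, Submodule.span_image, Module.Basis.span_eq, Submodule.map_top, LinearMap.range_eq_top]
  exact FreeAlg.mk_surjective M X

/-- In a 2-variety a product of three elements can be rewritten with a prescribed factor in the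
inner bracket. -/
theorem IsTwoVariety.mem_span_innerProducts [Infinite k] (hM : M.IsTwoVariety)
    {A : Type u} [NonUnitalNonAssocRing A] [Module k A] [IsScalarTower k A A]
    [SMulCommClass k A A] (hA : M.Models A) (a b w : A) :
    (a * b) * w ∈ Submodule.span k (innerProducts a b w) ∧
      w * (a * b) ∈ Submodule.span k (innerProducts a b w) := by
  let ev := FreeMagma.lift (FreeAlg.gen M (Fin 3))
  let S : Set (FreeMagma (Fin 3)) := {w | 0 ∈ letters w ∨ 1 ∈ letters w}
  -- The ideal generated by the first two generators.
  let I : Submodule k (M.FreeAlg (Fin 3)) := Submodule.span k (ev '' S)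
  have hI : IsIdeal I := by
    intro q p hp
    have hq : q ∈ Submodule.span k (Set.range ev) := by
      rw [span_range_lift_gen]
      trivial
    constructor
    · refine Submodule.span_mono ?_ (mul_mem_span_image2 hq hp)
      rintro _ ⟨_, ⟨u, rfl⟩, _, ⟨v, hv, rfl⟩, rfl⟩
      refine ⟨u * v, ?_, map_mul ev u v⟩
      simp only [S, Set.mem_ofPred_eq, letters_mul, Multiset.mem_add] at hv ⊢
      tauto
    · refine Submodule.span_mono ?_ (mul_mem_span_image2 hp hq)
      rintro _ ⟨_, ⟨u, hu, rfl⟩, _, ⟨v, rfl⟩, rfl⟩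
      refine ⟨u * v, ?_, map_mul ev u v⟩
      simp only [S, Set.mem_ofPred_eq, letters_mul, Multiset.mem_add] at hu ⊢
      tauto
  have hsq : square I ≤ Submodule.span k (ev '' Set.image2 (· * ·) S S) := by
    rw [square, Submodule.span_le]
    rintro _ ⟨p, hp, q, hq, rfl⟩
    refine Submodule.span_mono ?_ (mul_mem_span_image2 hp hq)
    rintro _ ⟨_, ⟨u, hu, rfl⟩, _, ⟨v, hv, rfl⟩, rfl⟩
    exact ⟨u * v, ⟨u, hu, v, hv, rfl⟩, map_mul ev u v⟩
  have hxy : ev (FreeMagma.of 0) * ev (FreeMagma.of 1) ∈ square I :=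
    Submodule.subset_span ⟨_, Submodule.subset_span ⟨_, by simp [S, letters_of], rfl⟩,
      _, Submodule.subset_span ⟨_, by simp [S, letters_of], rfl⟩, rfl⟩
  have hideal := hM _ (models_freeAlg M (Fin 3)) I hI (ev (FreeMagma.of 2)) _ hxy
  let f : Fin 3 → A := ![a, b, w]
  have main (t : FreeMagma (Fin 3)) (ht : letters t = {0, 1, 2}) (hmem : ev t ∈ square I) :
      eval hA f (ev t) ∈ Submodule.span k (innerProducts a b w) := by
    have h := mem_span_of_letters_eq (hsq hmem)
    have h' := Submodule.mem_map_of_mem (f := eval hA f) h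
    rw [← Submodule.span_image] at h'
    refine Submodule.span_mono ?_ h'
    rintro _ ⟨_, ⟨_, ⟨⟨u, hu, v, hv, rfl⟩, huv⟩, rfl⟩, rfl⟩
    have hev (t : FreeMagma (Fin 3)) :
        eval hA f (FreeMagma.lift (FreeAlg.gen M (Fin 3)) t) = FreeMagma.lift f t := by
      rw [← mk_wordBasis, eval_mk, lift_wordBasis]
    rw [hev]
    exact lift_mem_innerProducts f hu hv (huv.trans ht)
  have h1 := main (FreeMagma.of 0 * FreeMagma.of 1 * FreeMagma.of 2) rfl
    (by rw [map_mul, map_mul]; exact hideal.2)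
  have h2 := main (FreeMagma.of 2 * (FreeMagma.of 0 * FreeMagma.of 1)) (by decide)
    (by rw [map_mul, map_mul]; exact hideal.1)
  simp only [ev, map_mul, FreeMagma.lift_of, eval_mul, eval_gen] at h1 h2
  exact ⟨h1, h2⟩

end Identity

/-! ### Combs: reduction of words and counting -/

section Combs

variable {k : Type u} [Field k] {X : Type v} {A : Type*} [NonUnitalNonAssocRing A] [Module k A]

/-- Multiplication by the value of a letter, on the left or on the right. -/
def step (g : X → A) (c : Bool × X) (y : A) : A :=
  if c.1 then g c.2 * y else y * g c.2

variable (k) in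
/-- The span of the values of the words obtained from the letter `x` by successive left or right
multiplications by single letters, which together form the multiset `s`. -/
def combSpan (g : X → A) (x : X) (s : Multiset X) : Submodule k A :=
  Submodule.span k {z | ∃ l : List (Bool × X), (l.map Prod.snd : Multiset X) = s ∧
    l.foldr (step g) (g x) = z}

variable (k) in
/-- The span of the values of the words obtained from the letter `x` by successive left
multiplications by single letters, which together form the multiset `s`. -/
def leftCombSpan (g : X → A) (x : X) (s : Multiset X) : Submodule k A :=
  Submodule.span k {z | ∃ l : List X, (l : Multiset X) = s ∧
    l.foldr (fun a y ↦ g a * y) (g x) = z}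

section

variable [IsScalarTower k A A] [SMulCommClass k A A]

theorem letter_mul_mem_combSpan {g : X → A} {x : X} {s : Multiset X} (a : X) {y : A}
    (hy : y ∈ combSpan k g x s) :
    g a * y ∈ combSpan k g x ({a} + s) ∧ y * g a ∈ combSpan k g x ({a} + s) := by
  induction hy using Submodule.span_induction with
  | zero => simp
  | add y z _ _ hy hz =>
    rw [mul_add, add_mul]
    exact ⟨add_mem hy.1 hz.1, add_mem hy.2 hz.2⟩
  | smul c y _ hy =>
    rw [mul_smul_comm, smul_mul_assoc]
    exact ⟨Submodule.smul_mem _ _ hy.1, Submodule.smul_mem _ _ hy.2⟩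
  | mem y h =>
    obtain ⟨l, rfl, rfl⟩ := h
    exact ⟨Submodule.subset_span ⟨(true, a) :: l, rfl, rfl⟩,
      Submodule.subset_span ⟨(false, a) :: l, rfl, rfl⟩⟩

/-- Induction on the word: the rewriting rule moves `y` into an inner bracket with one factor of the
word, so the two shorter factors are absorbed one after the other. -/
theorem word_mul_mem_combSpan (h : ∀ a b w : A,
      (a * b) * w ∈ Submodule.span k (innerProducts a b w) ∧
      w * (a * b) ∈ Submodule.span k (innerProducts a b w))
    {g : X → A} {x : X} (v : FreeMagma X) {s : Multiset X} {y : A}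
    (hy : y ∈ combSpan k g x s) :
    FreeMagma.lift g v * y ∈ combSpan k g x (letters v + s) ∧
      y * FreeMagma.lift g v ∈ combSpan k g x (letters v + s) := by
  induction v generalizing s y with
  | ih1 a => exact letter_mul_mem_combSpan a hy
  | ih2 a b ha hb =>
    rw [map_mul, letters_mul]
    have hle : Submodule.span k (innerProducts (FreeMagma.lift g a) (FreeMagma.lift g b) y) ≤
        combSpan k g x (letters a + letters b + s) := by
      rw [Submodule.span_le]
      have e1 : letters a + letters b + s = letters b + (letters a + s) := by
        rw [add_comm (letters a), add_assoc]
      have e2 : letters a + letters b + s = letters a + (letters b + s) := add_assoc _ _ _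
      -- The eight inner products arise by absorbing `a` then `b`, or `b` then `a`, each on either
      -- side.
      have a1 := ha hy
      have b1 := hb hy
      have a2 := And.intro (hb a1.1) (hb a1.2)
      have b2 := And.intro (ha b1.1) (ha b1.2)
      rw [← e1] at a2
      rw [← e2] at b2
      rintro z (rfl | rfl | rfl | rfl | rfl | rfl | rfl | rfl)
      exacts [a2.1.2, a2.2.2, a2.1.1, a2.2.1, b2.1.2, b2.2.2, b2.1.1, b2.2.1]
    exact ⟨hle (h _ _ _).1, hle (h _ _ _).2⟩

/-- Exactly one splitting is needed at each level: a factor containing `x` is a combination of combs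
by induction, and the other factor is then absorbed into it. -/
theorem lift_mem_combSpan (h : ∀ a b w : A,
      (a * b) * w ∈ Submodule.span k (innerProducts a b w) ∧
      w * (a * b) ∈ Submodule.span k (innerProducts a b w))
    {g : X → A} {x : X} (v : FreeMagma X) (s : Multiset X) (hv : letters v = {x} + s) :
    FreeMagma.lift g v ∈ combSpan k g x s := by
  induction v generalizing s with
  | ih1 a =>
    rw [letters_of, Multiset.singleton_add, Multiset.singleton_eq_cons_iff] at hv
    obtain ⟨rfl, rfl⟩ := hv
    exact Submodule.subset_span ⟨[], rfl, rfl⟩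
  | ih2 a b ha hb =>
    rw [letters_mul] at hv
    have hx : x ∈ letters a + letters b := by simp [hv]
    rw [map_mul]
    rcases Multiset.mem_add.1 hx with hx | hx
    · obtain ⟨t, ht⟩ := Multiset.exists_cons_of_mem hx
      rw [← Multiset.singleton_add] at ht
      rw [ht, add_assoc, add_right_inj] at hv
      rw [← hv, add_comm]
      exact (word_mul_mem_combSpan h b (ha t ht)).2
    · obtain ⟨t, ht⟩ := Multiset.exists_cons_of_mem hx
      rw [← Multiset.singleton_add] at ht
      rw [ht, add_left_comm, add_right_inj] at hv
      rw [← hv]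
      exact (word_mul_mem_combSpan h a (hb t ht)).1

end

section

variable [SMulCommClass k A A]

theorem combSpan_le_leftCombSpan {ε : k} (h : ∀ a b : A, a * b = ε • (b * a)) (g : X → A) (x : X)
    (s : Multiset X) : combSpan k g x s ≤ leftCombSpan k g x s := by
  rw [combSpan, Submodule.span_le]
  rintro _ ⟨l, rfl, rfl⟩
  have key : ∃ c : k, l.foldr (step g) (g x) =
      c • (l.map Prod.snd).foldr (fun a y ↦ g a * y) (g x) := by
    induction l with
    | nil => exact ⟨1, (one_smul _ _).symm⟩
    | cons a l ih =>
      obtain ⟨c, hc⟩ := ih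
      obtain ⟨_ | _, a⟩ := a
      · refine ⟨ε * c, ?_⟩
        simp [step, hc, h _ (g a), mul_smul, mul_smul_comm]
      · refine ⟨c, ?_⟩
        simp [step, hc, mul_smul_comm]
  obtain ⟨c, hc⟩ := key
  rw [hc]
  exact Submodule.smul_mem _ _ (Submodule.subset_span ⟨_, rfl, rfl⟩)

/-- Permutations are generated by adjacent swaps, and each swap costs a factor `δ`. -/
theorem rank_leftCombSpan_le_one {δ : k} (h : ∀ a b c : A, a * (b * c) = δ • (b * (a * c)))
    (g : X → A) (x : X) (s : Multiset X) : Module.rank k (leftCombSpan k g x s) ≤ 1 := by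
  rw [rank_submodule_le_one_iff']
  refine ⟨s.toList.foldr (fun a y ↦ g a * y) (g x), ?_⟩
  have key {l l' : List X} (hl : l.Perm l') :
      ∃ c : k, l.foldr (fun a y ↦ g a * y) (g x) = c • l'.foldr (fun a y ↦ g a * y) (g x) := by
    induction hl with
    | nil => exact ⟨1, (one_smul _ _).symm⟩
    | cons a _ ih =>
      obtain ⟨c, hc⟩ := ih
      exact ⟨c, by simp [hc, mul_smul_comm]⟩
    | swap a b l => exact ⟨δ, h _ _ _⟩
    | trans _ _ ih₁ ih₂ =>
      obtain ⟨c, hc⟩ := ih₁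
      obtain ⟨d, hd⟩ := ih₂
      exact ⟨c * d, by rw [hc, hd, mul_smul]⟩
  rw [leftCombSpan, Submodule.span_le]
  rintro _ ⟨l, rfl, rfl⟩
  obtain ⟨c, hc⟩ := key (l := l) (l' := (l : Multiset X).toList)
    (Multiset.coe_eq_coe.1 (Multiset.coe_toList _).symm)
  rw [hc]
  exact Submodule.smul_mem _ _ (Submodule.mem_span_singleton_self _)

end

theorem rank_leftCombSpan_le (g : X → A) (x : X) (s : Multiset X) :
    Module.rank k (leftCombSpan k g x s) ≤ (s.card.factorial : ℕ) := by
  classical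
  let T : Finset A :=
    s.toList.permutations.toFinset.image fun l ↦ l.foldr (fun a y ↦ g a * y) (g x)
  have hle : leftCombSpan k g x s ≤ Submodule.span k (T : Set A) := by
    refine Submodule.span_mono ?_
    rintro _ ⟨l, rfl, rfl⟩
    refine Finset.mem_coe.2 (Finset.mem_image_of_mem _ ?_)
    rw [List.mem_toFinset, List.mem_permutations]
    exact Multiset.coe_eq_coe.1 (Multiset.coe_toList _).symm
  refine (Submodule.rank_mono hle).trans ((rank_span_finset_le T).trans ?_)
  have hT : T.card ≤ s.card.factorial :=
    Finset.card_image_le.trans <| (List.toFinset_card_le _).trans_eq <| by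
      rw [List.length_permutations, Multiset.length_toList]
  exact_mod_cast hT

theorem rank_combSpan_le (g : X → A) (x : X) (s : Multiset X) :
    Module.rank k (combSpan k g x s) ≤ (2 ^ s.card * s.card.factorial : ℕ) := by
  classical
  let T : Finset A :=
    ((Finset.univ : Finset (List.Vector Bool s.card)) ×ˢ s.toList.permutations.toFinset).image
      fun c ↦ (c.1.toList.zip c.2).foldr (step g) (g x)
  have hle : combSpan k g x s ≤ Submodule.span k (T : Set A) := by
    refine Submodule.span_mono ?_
    rintro _ ⟨l, rfl, rfl⟩
    refine Finset.mem_coe.2 (Finset.mem_image.2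
      ⟨(⟨l.map Prod.fst, by simp⟩, l.map Prod.snd), ?_, ?_⟩)
    · rw [Finset.mem_product, List.mem_toFinset, List.mem_permutations]
      exact ⟨Finset.mem_univ _, Multiset.coe_eq_coe.1 (Multiset.coe_toList _).symm⟩
    · have : (l.map Prod.fst).zip (l.map Prod.snd) = l := by
        simpa [List.unzip_eq_map] using List.zip_unzip l
      exact congrArg (List.foldr (step g) (g x)) this
  refine (Submodule.rank_mono hle).trans ((rank_span_finset_le T).trans ?_)
  have hT : T.card ≤ 2 ^ s.card * s.card.factorial := by
    refine Finset.card_image_le.trans ?_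
    rw [Finset.card_product, Finset.card_univ, card_vector, Fintype.card_bool]
    refine Nat.mul_le_mul_left _ ((List.toFinset_card_le _).trans_eq ?_)
    rw [List.length_permutations, Multiset.length_toList]
  exact_mod_cast hT

end Combs

/-! ### Dimension bounds and the consequences of small O(2) and O(3) -/

section Operad

variable {k : Type u} [Field k] {M : NAVariety k}

theorem IsTwoVariety.operad_le_combSpan [Infinite k] (hM : M.IsTwoVariety) (m : ℕ) :
    M.operad (m + 1) ≤ combSpan k (FreeAlg.gen M (Fin (m + 1))) 0 (Finset.univ.val.erase 0) := by
  rw [operad, Submodule.span_le]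
  rintro _ ⟨w, hw, rfl⟩
  refine lift_mem_combSpan (hM.mem_span_innerProducts (models_freeAlg M _)) w _ ?_
  rw [Multiset.singleton_add, Multiset.cons_erase (Finset.mem_univ_val _)]
  ext i
  rw [hw i, Multiset.count_eq_one_of_mem Finset.univ.nodup (Finset.mem_univ_val i)]

theorem card_univ_val_erase_zero (m : ℕ) :
    ((Finset.univ : Finset (Fin (m + 1))).val.erase 0).card = m := by
  simp [Multiset.card_erase_of_mem]

theorem IsTwoVariety.rank_operad_le [Infinite k] (hM : M.IsTwoVariety) {n : ℕ} (hn : 1 ≤ n) :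
    Module.rank k (M.operad n) ≤ ((2 ^ (n - 1) * (n - 1).factorial : ℕ) : Cardinal) := by
  obtain ⟨m, rfl⟩ := Nat.exists_eq_add_of_le' hn
  have h := rank_combSpan_le (k := k) (FreeAlg.gen M (Fin (m + 1))) 0 (Finset.univ.val.erase 0)
  rw [card_univ_val_erase_zero] at h
  exact (Submodule.rank_mono (hM.operad_le_combSpan m)).trans h

/-- Every algebra of `M` satisfies `a * b = ε • (b * a)`. -/
def IsCommutativeUpTo (M : NAVariety k) (ε : k) : Prop :=
  ∀ (A : Type u) [NonUnitalNonAssocRing A] [Module k A] [IsScalarTower k A A]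
    [SMulCommClass k A A], M.Models A → ∀ a b : A, a * b = ε • (b * a)

theorem IsTwoVariety.rank_operad_le_of_commutative [Infinite k] (hM : M.IsTwoVariety) {ε : k}
    (hε : M.IsCommutativeUpTo ε) {n : ℕ} (hn : 1 ≤ n) :
    Module.rank k (M.operad n) ≤ ((n - 1).factorial : Cardinal) := by
  obtain ⟨m, rfl⟩ := Nat.exists_eq_add_of_le' hn
  have h := rank_leftCombSpan_le (k := k) (FreeAlg.gen M (Fin (m + 1))) 0
    (Finset.univ.val.erase 0)
  rw [card_univ_val_erase_zero] at h
  exact (Submodule.rank_mono ((hM.operad_le_combSpan m).trans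
    (combSpan_le_leftCombSpan (hε _ (models_freeAlg M _)) _ _ _))).trans h

/-- Every algebra of `M` satisfies `a * (b * c) = δ • (b * (a * c))`. -/
def IsLeftCommutativeUpTo (M : NAVariety k) (δ : k) : Prop :=
  ∀ (A : Type u) [NonUnitalNonAssocRing A] [Module k A] [IsScalarTower k A A]
    [SMulCommClass k A A], M.Models A → ∀ a b c : A, a * (b * c) = δ • (b * (a * c))

theorem IsTwoVariety.rank_operad_le_one [Infinite k] (hM : M.IsTwoVariety) {ε δ : k}
    (hε : M.IsCommutativeUpTo ε) (hδ : M.IsLeftCommutativeUpTo δ) {n : ℕ} (hn : 1 ≤ n) :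
    Module.rank k (M.operad n) ≤ 1 := by
  obtain ⟨m, rfl⟩ := Nat.exists_eq_add_of_le' hn
  exact (Submodule.rank_mono ((hM.operad_le_combSpan m).trans
    (combSpan_le_leftCombSpan (hε _ (models_freeAlg M _)) _ _ _))).trans
    (rank_leftCombSpan_le_one (hδ _ (models_freeAlg M _)) _ _ _)

theorem exists_linear_relation {V : Type*} [AddCommGroup V] [Module k V] {v p q : V}
    (hp : p ∈ k ∙ v) (hq : q ∈ k ∙ v) :
    ∃ a b : k, (a ≠ 0 ∨ b ≠ 0) ∧ a • p + b • q = 0 := by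
  obtain ⟨α, rfl⟩ := Submodule.mem_span_singleton.1 hp
  obtain ⟨β, rfl⟩ := Submodule.mem_span_singleton.1 hq
  by_cases h : α = 0
  · exact ⟨1, 0, Or.inl one_ne_zero, by simp [h]⟩
  · refine ⟨-β, α, Or.inr h, ?_⟩
    module

theorem add_ne_zero_or_sub_ne_zero [CharZero k] {a b : k} (h : a ≠ 0 ∨ b ≠ 0) :
    a + b ≠ 0 ∨ a - b ≠ 0 := by
  by_contra! hc
  have ha : 2 * a = 0 := by linear_combination hc.1 + hc.2
  have hb : 2 * b = 0 := by linear_combination hc.1 - hc.2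
  simp_all

theorem eq_neg_of_symmetric_relation {V : Type*} [AddCommGroup V] [Module k V] {a b : k}
    (hab : a + b ≠ 0) {p q : V} (h : a • p + b • q = 0) (h' : a • q + b • p = 0) : p = -q := by
  have hs : (a + b) • (p + q) = 0 := by
    rw [show (a + b) • (p + q) = (a • p + b • q) + (a • q + b • p) by module, h, h', add_zero]
  exact eq_neg_of_add_eq_zero_left ((smul_eq_zero.1 hs).resolve_left hab)

theorem eq_of_symmetric_relation {V : Type*} [AddCommGroup V] [Module k V] {a b : k}
    (hab : a - b ≠ 0) {p q : V} (h : a • p + b • q = 0) (h' : a • q + b • p = 0) : p = q := by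
  have hs : (a - b) • (p - q) = 0 := by
    rw [show (a - b) • (p - q) = (a • p + b • q) - (a • q + b • p) by module, h, h', sub_zero]
  exact sub_eq_zero.1 ((smul_eq_zero.1 hs).resolve_left hab)

/-- The two products of two generators are linearly dependent. Exchanging the variables makes the
relation symmetric, and adding or subtracting the two versions isolates a sign. -/
theorem exists_isCommutativeUpTo [CharZero k] (h : Module.rank k (M.operad 2) ≤ 1) :
    ∃ ε : k, (ε = 1 ∨ ε = -1) ∧ M.IsCommutativeUpTo ε := by
  obtain ⟨v, hv⟩ := (rank_submodule_le_one_iff' _).1 h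
  let g := FreeAlg.gen M (Fin 2)
  have h1 : g 0 * g 1 ∈ M.operad 2 :=
    Submodule.subset_span ⟨FreeMagma.of 0 * FreeMagma.of 1, by decide, by simp [g]⟩
  have h2 : g 1 * g 0 ∈ M.operad 2 :=
    Submodule.subset_span ⟨FreeMagma.of 1 * FreeMagma.of 0, by decide, by simp [g]⟩
  obtain ⟨a, b, hab, hrel⟩ := exists_linear_relation (hv h1) (hv h2)
  have key (A : Type u) [NonUnitalNonAssocRing A] [Module k A] [IsScalarTower k A A]
      [SMulCommClass k A A] (hA : M.Models A) (x y : A) :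
      a • (x * y) + b • (y * x) = 0 := by
    have := congrArg (eval hA ![x, y]) hrel
    simpa [g, eval_mul, eval_gen] using this
  rcases add_ne_zero_or_sub_ne_zero hab with hab | hab
  · refine ⟨-1, Or.inr rfl, fun A _ _ _ _ hA x y ↦ ?_⟩
    rw [neg_one_smul]
    exact eq_neg_of_symmetric_relation hab (key A hA x y) (key A hA y x)
  · refine ⟨1, Or.inl rfl, fun A _ _ _ _ hA x y ↦ ?_⟩
    rw [one_smul]
    exact eq_of_symmetric_relation hab (key A hA x y) (key A hA y x)

theorem exists_isLeftCommutativeUpTo [CharZero k] {ε : k} (hε0 : ε ≠ 0)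
    (hε : M.IsCommutativeUpTo ε) (h : Module.rank k (M.operad 3) ≤ 1) :
    ∃ δ : k, M.IsLeftCommutativeUpTo δ := by
  obtain ⟨v, hv⟩ := (rank_submodule_le_one_iff' _).1 h
  let g := FreeAlg.gen M (Fin 3)
  have h1 : g 1 * g 2 * g 0 ∈ M.operad 3 :=
    Submodule.subset_span ⟨FreeMagma.of 1 * FreeMagma.of 2 * FreeMagma.of 0, by decide, by simp [g]⟩
  have h2 : g 2 * g 0 * g 1 ∈ M.operad 3 :=
    Submodule.subset_span ⟨FreeMagma.of 2 * FreeMagma.of 0 * FreeMagma.of 1, by decide, by simp [g]⟩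
  obtain ⟨a, b, hab, hrel⟩ := exists_linear_relation (hv h1) (hv h2)
  have cyclic (A : Type u) [NonUnitalNonAssocRing A] [Module k A] [IsScalarTower k A A]
      [SMulCommClass k A A] (hA : M.Models A) (x y z : A) : y * z * x = z * x * y := by
    have key (x y z : A) : a • (y * z * x) + b • (z * x * y) = 0 := by
      have := congrArg (eval hA ![x, y, z]) hrel
      simpa [g, eval_mul, eval_gen] using this
    -- Exchanging `x` and `y` swaps the two monomials, up to a common factor `ε`.
    have key' (x y z : A) : a • (z * x * y) + b • (y * z * x) = 0 := by
      have := key y x z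
      rw [hε A hA x z, hε A hA z y, smul_mul_assoc, smul_mul_assoc, smul_comm a, smul_comm b,
        ← smul_add] at this
      exact (smul_eq_zero.1 this).resolve_left hε0
    rcases add_ne_zero_or_sub_ne_zero hab with hab | hab
    · have e (x y z : A) : y * z * x = -(z * x * y) :=
        eq_neg_of_symmetric_relation hab (key x y z) (key' x y z)
      -- A cyclic shift has order three, so a sign change at each shift makes the product its own
      -- negative.
      have h0 (x y z : A) : y * z * x = 0 := by
        have e1 : y * z * x = -(y * z * x) := by
          conv_lhs => rw [e x y z, e y z x, e z x y, neg_neg]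
        have e2 : (2 : k) • (y * z * x) = 0 := by
          rw [two_smul]
          exact add_eq_zero_iff_eq_neg.2 e1
        exact (smul_eq_zero.1 e2).resolve_left two_ne_zero
      rw [h0, h0]
    · exact eq_of_symmetric_relation hab (key x y z) (key' x y z)
  -- x(yz) = ε (yz)x = ε (zx)y = ε² y(zx) = ε³ y(xz).
  refine ⟨ε * (ε * ε), fun A _ _ _ _ hA x y z ↦ ?_⟩
  rw [hε A hA x (y * z), cyclic A hA x y z, hε A hA (z * x) y, hε A hA z x, mul_smul_comm,
    mul_smul, mul_smul]

theorem isTrivial_of_operad_two_eq_bot (h : M.operad 2 = ⊥) : M.IsTrivial := by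
  intro A _ _ _ _ hA a b
  let g := FreeAlg.gen M (Fin 2)
  have h1 : g 0 * g 1 ∈ M.operad 2 :=
    Submodule.subset_span ⟨FreeMagma.of 0 * FreeMagma.of 1, by decide, by simp [g]⟩
  rw [h, Submodule.mem_bot] at h1
  have := congrArg (eval hA ![a, b]) h1
  simpa [g, eval_mul, eval_gen] using this

end Operad

end NAVariety

theorem lemma3p3 {k : Type u} [Field k] [CharZero k] (M : NAVariety k) (hM : M.IsTwoVariety) :
    (M.operad 2 = ⊥ ∧ M.IsTrivial) ∨
    (Module.rank k (M.operad 2) = 1 ∧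
      ((Module.rank k (M.operad 3) = 2 ∧
          ∀ n : ℕ, 1 ≤ n → Module.rank k (M.operad n) ≤ ((Nat.factorial (n - 1) : ℕ) : Cardinal)) ∨
        (Module.rank k (M.operad 3) = 1 ∧
          ∀ n : ℕ, 1 ≤ n → Module.rank k (M.operad n) ≤ 1) ∨
        Module.rank k (M.operad 3) = 0)) ∨
    (Module.rank k (M.operad 2) = 2 ∧
      ∀ n : ℕ, 1 ≤ n →
        Module.rank k (M.operad n) ≤ ((2 ^ (n - 1) * Nat.factorial (n - 1) : ℕ) : Cardinal)) := by
  have hinf : Infinite k := CharZero.infinite k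
  -- The general bound at n = 2 is 2¹ · 1! = 2.
  have h2 : Module.rank k (M.operad 2) ≤ (2 : ℕ) := hM.rank_operad_le (n := 2) one_le_two
  obtain ⟨r, hr, hr2⟩ := Cardinal.exists_nat_eq_of_le_nat h2
  interval_cases r
  · have hbot : M.operad 2 = ⊥ := Submodule.rank_eq_zero.1 (by simpa using hr2)
    exact Or.inl ⟨hbot, NAVariety.isTrivial_of_operad_two_eq_bot hbot⟩
  · have hr2 : Module.rank k (M.operad 2) = 1 := by simpa using hr2
    obtain ⟨ε, hε1, hε⟩ := NAVariety.exists_isCommutativeUpTo hr2.le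
    have hε0 : ε ≠ 0 := by rcases hε1 with rfl | rfl <;> simp
    have h3 : Module.rank k (M.operad 3) ≤ (2 : ℕ) :=
      hM.rank_operad_le_of_commutative hε (n := 3) (by norm_num)
    obtain ⟨s, hs, hs3⟩ := Cardinal.exists_nat_eq_of_le_nat h3
    refine Or.inr (Or.inl ⟨hr2, ?_⟩)
    interval_cases s
    · exact Or.inr (Or.inr (by simpa using hs3))
    · have hs3 : Module.rank k (M.operad 3) = 1 := by simpa using hs3
      obtain ⟨δ, hδ⟩ := NAVariety.exists_isLeftCommutativeUpTo hε0 hε hs3.le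
      exact Or.inr (Or.inl ⟨hs3, fun n hn ↦ hM.rank_operad_le_one hε hδ hn⟩)
    · exact Or.inl ⟨by simpa using hs3, fun n hn ↦ hM.rank_operad_le_of_commutative hε hn⟩
  · exact Or.inr (Or.inr ⟨by simpa using hr2, fun n hn ↦ hM.rank_operad_le hn⟩)
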